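/- A skew (left) brace is a set $B$ with two operations $+$ and $\cdot$ such that $(B,+)$ and $(B,\cdot)$ are groups (not necessarily abelian) and $x\cdot(y+z)=x\cdot y-x+x\cdot z$ for all $x,y,z\in B$; the two groups have the same identity $0$. For $a,b\in B$ put $\lambda_a(b)=-a+a\cdot b$; then $\lambda:(B,\cdot)\to\operatorname{Aut}(B,+)$ is a homomorphism, and $\operatorname{Soc}(B)=\operatorname{Ker}\lambda\cap Z(B,+)$. A subbrace of $B$ is a subset that is a subgroup of both $(B,+)$ and $(B,\cdot)$; an ideal is a subbrace $I$ that is normal in $(B,+)$ and in $(B,\cdot)$ and satisfies $\lambda_b(I)\subseteq I$ for all $b\in B$; then $B/I$ is a skew brace. A maximal subbrace is a proper subbrace that is not contained in any other proper subbrace. The skew brace $B$ is supersoluble if it has a finite chain of ideals $\{0\}=I_0\le I_1\le\dots\le I_n=B$ such that, for all $0\le i<n$, either $(I_{i+1}/I_i,+)$ is infinite cyclic and $I_{i+1}/I_i\le\operatorname{Soc}(B/I_i)$, or $I_{i+1}/I_i$ has prime order. If $C$ is a subbrace of $B$ such that the indices $|(B,+):(C,+)|$ and $|(B,\cdot):(C,\cdot)|$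 are finite and equal, their common value is called the index $|B:C|$. **Theorem.** Let $B$ be a supersoluble skew brace and let $C$ be a maximal subbrace of $B$. Then the index $|B:C|$ exists and is a prime number. In particular, $(C,+)$ is a maximal subgroup of $(B,+)$ of prime index, and $(C,\cdot)$ is a maximal subgroup of $(B,\cdot)$ of prime index. -/

import Mathlib

/-- A skew (left) brace: two group structures `(B, +)` and `(B, *)` on the same set (neither is
assumed commutative) satisfying the skew distributive law `x (y + z) = x y - x + x z`. -/
class SkewBrace (B : Type*) extends AddGroup B, Group B where
  skew_distrib : ∀ x y z : B, x * (y + z) = x * y - x + x * z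

namespace SkewBrace

variable {B : Type*} [SkewBrace B]

theorem mul_zero_eq (x : B) : x * 0 = x := by
  have h := skew_distrib x 0 0
  rw [add_zero] at h
  have h2 : x * 0 - x = 0 := by
    have h3 : 0 + x * 0 = (x * 0 - x) + x * 0 := by rw [zero_add]; exact h
    exact (add_right_cancel h3).symm
  exact sub_eq_zero.mp h2

theorem one_eq_zero : (1 : B) = 0 := by
  have h := mul_zero_eq (1 : B)
  rw [one_mul] at h
  exact h.symm

theorem lam_add_aux (a b c : B) : -a + a * (b + c) = (-a + a * b) + (-a + a * c) := by
  rw [skew_distrib, sub_eq_add_neg]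
  simp only [add_assoc]

theorem lam_mul_aux (a b c : B) : -(a * b) + (a * b) * c = -a + a * (-b + b * c) := by
  have h : a * (b * c) = a * b - a + a * (-b + b * c) := by
    rw [← skew_distrib, add_neg_cancel_left]
  rw [mul_assoc, h, sub_eq_add_neg, add_assoc, neg_add_cancel_left]

/-- The automorphism `lam_a : b ↦ -a + a b` of `(B, +)`. -/
def lam (a : B) : B ≃+ B where
  toFun b := -a + a * b
  invFun b := -a⁻¹ + a⁻¹ * b
  left_inv b := by
    change -a⁻¹ + a⁻¹ * (-a + a * b) = b
    rw [← lam_mul_aux, inv_mul_cancel, one_mul, one_eq_zero, neg_zero, zero_add]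
  right_inv b := by
    change -a + a * (-a⁻¹ + a⁻¹ * b) = b
    rw [← lam_mul_aux, mul_inv_cancel, one_mul, one_eq_zero, neg_zero, zero_add]
  map_add' b c := lam_add_aux a b c

theorem lam_apply (a b : B) : lam a b = -a + a * b := rfl

/-- `a ↦ lam_a` is a homomorphism from `(B, *)` to the automorphism group of `(B, +)`. -/
theorem lam_mul (a b c : B) : lam (a * b) c = lam a (lam b c) := lam_mul_aux a b c

theorem lam_one (b : B) : lam 1 b = b := by
  rw [lam_apply, one_mul, one_eq_zero, neg_zero, zero_add]

variable (B) in
/-- The socle `Soc(B) = Ker lam ∩ Z(B, +)`. -/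
def socle : Set B :=
  {a : B | lam a = AddEquiv.refl B} ∩ (AddSubgroup.center B : Set B)

variable (B) in
/-- A subbrace: a subset which is a subgroup of both `(B, +)` and `(B, *)`. -/
structure Subbrace extends AddSubgroup B, Subgroup B

namespace Subbrace

instance : SetLike (Subbrace B) B where
  coe C := C.carrier
  coe_injective C D h := by
    cases C; cases D
    congr
    exact SetLike.coe_injective h

/-- Subbraces are ordered by inclusion. -/
instance : PartialOrder (Subbrace B) := PartialOrder.ofSetLike (Subbrace B) B

instance : OrderTop (Subbrace B) where
  top :=
    { (⊤ : AddSubgroup B) with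
      mul_mem' := fun _ _ => trivial
      one_mem' := trivial
      inv_mem' := fun _ => trivial }
  le_top _ _ _ := trivial

/-- `C` has (finite) index `n` in `B`: both `(C, +)` in `(B, +)` and `(C, *)` in `(B, *)` have
finite index, and both indices are equal to `n`. -/
def HasIndex (C : Subbrace B) (n : ℕ) : Prop :=
  C.toAddSubgroup.FiniteIndex ∧ C.toSubgroup.FiniteIndex ∧
    C.toAddSubgroup.index = n ∧ C.toSubgroup.index = n

end Subbrace

variable (B) in
/-- An ideal: a subbrace that is invariant under all `lam_b`, normal in `(B, +)` and normal in
`(B, *)`. -/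
structure BraceIdeal extends Subbrace B where
  lam_mem : ∀ (b : B) {x : B}, x ∈ carrier → lam b x ∈ carrier
  add_normal : toAddSubgroup.Normal
  mul_normal : toSubgroup.Normal

namespace BraceIdeal

variable (I : BraceIdeal B)

instance : I.toAddSubgroup.Normal := I.add_normal

instance : I.toSubgroup.Normal := I.mul_normal

/-- Additive and multiplicative cosets of an ideal agree. -/
theorem neg_add_mem_iff (a b : B) : -a + b ∈ I.toAddSubgroup ↔ a⁻¹ * b ∈ I.toSubgroup := by
  have h1 : -a + b = lam a (a⁻¹ * b) := by rw [lam_apply, mul_inv_cancel_left]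
  have h2 : a⁻¹ * b = lam a⁻¹ (-a + b) := by
    rw [h1, ← lam_mul, inv_mul_cancel, lam_one]
  constructor
  · intro h
    rw [h2]
    exact I.lam_mem a⁻¹ h
  · intro h
    rw [h1]
    exact I.lam_mem a h

/-- The underlying set of the quotient brace `B / I`: the cosets `b + I = b I`. -/
def Quot : Type _ := B ⧸ I.toAddSubgroup

namespace Quot

instance : AddGroup I.Quot := inferInstanceAs (AddGroup (B ⧸ I.toAddSubgroup))

/-- The projection `B → B / I` as a homomorphism of additive groups. -/
def mkAdd : B →+ I.Quot := QuotientAddGroup.mk' I.toAddSubgroup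

theorem mkAdd_surjective : Function.Surjective (mkAdd I) :=
  QuotientAddGroup.mk'_surjective I.toAddSubgroup

theorem mkAdd_eq_iff (a b : B) : mkAdd I a = mkAdd I b ↔ a⁻¹ * b ∈ I.toSubgroup :=
  (QuotientAddGroup.eq (s := I.toAddSubgroup)).trans (I.neg_add_mem_iff a b)

/-- Multiplication on `B / I`, induced by that of `B`. -/
instance : Mul I.Quot where
  mul := Quotient.map₂ (· * ·) (by
    intro a a' ha b b' hb
    refine Quotient.exact ((mkAdd_eq_iff I (a * b) (a' * b')).mpr ?_)
    have ha' : a⁻¹ * a' ∈ I.toSubgroup := (mkAdd_eq_iff I a a').mp (Quotient.sound ha)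
    have hb' : b⁻¹ * b' ∈ I.toSubgroup := (mkAdd_eq_iff I b b').mp (Quotient.sound hb)
    have h := I.toSubgroup.mul_mem (I.mul_normal.conj_mem _ ha' b⁻¹) hb'
    have e : (a * b)⁻¹ * (a' * b') = b⁻¹ * (a⁻¹ * a') * b⁻¹⁻¹ * (b⁻¹ * b') := by group
    rw [e]
    exact h)

/-- Inversion on `B / I`, induced by that of `B`. -/
instance : Inv I.Quot where
  inv := Quotient.map (·⁻¹) (by
    intro a a' ha
    refine Quotient.exact ((mkAdd_eq_iff I a⁻¹ a'⁻¹).mpr ?_)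
    have ha' : a⁻¹ * a' ∈ I.toSubgroup := (mkAdd_eq_iff I a a').mp (Quotient.sound ha)
    have h := I.mul_normal.conj_mem _ (I.toSubgroup.inv_mem ha') a
    have e : a⁻¹⁻¹ * a'⁻¹ = a * (a⁻¹ * a')⁻¹ * a⁻¹ := by group
    rw [e]
    exact h)

instance : One I.Quot := ⟨mkAdd I 1⟩

theorem mkAdd_mul (a b : B) : mkAdd I (a * b) = mkAdd I a * mkAdd I b := rfl

theorem mkAdd_one : mkAdd I 1 = 1 := rfl

theorem mkAdd_inv (a : B) : mkAdd I a⁻¹ = (mkAdd I a)⁻¹ := rfl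

instance : Group I.Quot :=
  Group.ofLeftAxioms
    (by
      intro x y z
      obtain ⟨a, rfl⟩ := mkAdd_surjective I x
      obtain ⟨b, rfl⟩ := mkAdd_surjective I y
      obtain ⟨c, rfl⟩ := mkAdd_surjective I z
      simp only [← mkAdd_mul, mul_assoc])
    (by
      intro x
      obtain ⟨a, rfl⟩ := mkAdd_surjective I x
      rw [← mkAdd_one, ← mkAdd_mul, one_mul])
    (by
      intro x
      obtain ⟨a, rfl⟩ := mkAdd_surjective I x
      rw [← mkAdd_inv, ← mkAdd_mul, inv_mul_cancel, mkAdd_one])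

/-- The quotient brace `B / I`. -/
instance : SkewBrace I.Quot where
  skew_distrib x y z := by
    obtain ⟨a, rfl⟩ := mkAdd_surjective I x
    obtain ⟨b, rfl⟩ := mkAdd_surjective I y
    obtain ⟨c, rfl⟩ := mkAdd_surjective I z
    rw [← map_add, ← mkAdd_mul, skew_distrib, map_add, map_sub, mkAdd_mul, mkAdd_mul]

end Quot

/-- The factor `(J / I, +)`, as a subgroup of `(B / I, +)` (used for ideals `I ≤ J`). -/
def factor (J : BraceIdeal B) : AddSubgroup I.Quot := J.toAddSubgroup.map (Quot.mkAdd I)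

end BraceIdeal

variable (B) in
/-- `B` is supersoluble: there is a finite chain of ideals `{0} = I 0 ≤ I 1 ≤ ... ≤ I n = B` such
that for each `i < n`, either `(I (i+1) / I i, +)` is infinite cyclic and
`I (i+1) / I i ≤ Soc(B / I i)`, or `I (i+1) / I i` has prime order. -/
def IsSupersoluble : Prop :=
  ∃ (n : ℕ) (I : ℕ → BraceIdeal B),
    ((I 0).carrier = {0}) ∧ ((I n).carrier = Set.univ) ∧
    ∀ i < n, (I i).toSubbrace ≤ (I (i + 1)).toSubbrace ∧
      ((IsAddCyclic ((I i).factor (I (i + 1))) ∧ Infinite ((I i).factor (I (i + 1))) ∧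
          ((I i).factor (I (i + 1)) : Set (I i).Quot) ⊆ socle (I i).Quot) ∨
        (Nat.card ((I i).factor (I (i + 1)))).Prime)

end SkewBrace

/-!
In a chain of ideals from `0` to `B`, take a step `I ≤ J` with `I ≤ C` but `J ≰ C`, and pass to
`B / I`, so that `I = 0`. By supersolubility every additive subgroup of `J` is then an ideal of `B`.
If `M` is an ideal with `C ∩ J < M ≤ J`, maximality of `C` gives `C + M = B`, and Dedekind's law
forces `M = J`. Thus `C ∩ J` is a normal maximal subgroup of `(J, +)`, and `|J : C ∩ J|` is prime.
Since `C ∩ J` is an ideal, this index is the same for both operations, and `C + J = B = C J`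
identifies it with the two indices of `C` in `B`.
-/

section GroupTheory

variable {G : Type*} [Group G] {H N : Subgroup G}

@[to_additive]
theorem isCoatom_subgroup_of_prime_index (hH : H.index.Prime) : IsCoatom H := by
  refine ⟨fun htop => hH.ne_one (Subgroup.index_eq_one.mpr htop), fun K hHK => ?_⟩
  have hrel : H.relIndex K ≠ 1 := fun h => hHK.not_ge (Subgroup.relIndex_eq_one.mp h)
  rw [← Subgroup.relIndex_mul_index hHK.le, Nat.prime_mul_iff] at hH
  exact Subgroup.index_eq_one.mp (hH.resolve_right fun h => hrel h.2).2

@[to_additive]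
theorem prime_card_of_isSimpleOrder_subgroup [IsSimpleOrder (Subgroup G)] :
    (Nat.card G).Prime := by
  have : Nontrivial G := Subgroup.nontrivial_iff.mp inferInstance
  obtain ⟨g, hg⟩ := exists_ne (1 : G)
  have : IsCyclic G := isCyclic_iff_exists_zpowers_eq_top.mpr
    ⟨g, (eq_bot_or_eq_top _).resolve_left fun h => hg (Subgroup.zpowers_eq_bot.mp h)⟩
  have : IsSimpleGroup G := ⟨fun K _ => eq_bot_or_eq_top K⟩
  exact Group.is_simple_iff_prime_card.mp inferInstance

@[to_additive]
theorem prime_index_of_isCoatom_subgroup [H.Normal] (hH : IsCoatom H) : H.index.Prime := by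
  have : IsSimpleOrder (Set.Ici H) := Set.isSimpleOrder_Ici_iff_isCoatom.mpr hH
  have e : Subgroup (G ⧸ H) ≃o Set.Ici H := QuotientGroup.comapMk'OrderIso H
  have : IsSimpleOrder (Subgroup (G ⧸ H)) := e.isSimpleOrder_iff.mpr this
  exact prime_card_of_isSimpleOrder_subgroup

@[to_additive]
theorem prime_relIndex_of_subgroup_covBy [H.Normal] (h : H ⋖ N) : (H.relIndex N).Prime := by
  let e : Set.Iic N ≃o Subgroup N := (Subgroup.MapSubtype.orderIso N).symm
  have hH : IsCoatom (⟨H, h.le⟩ : Set.Iic N) := Set.Iic.isCoatom_iff.mpr h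
  exact prime_index_of_isCoatom_subgroup ((e.isCoatom_iff _).mpr hH)

@[to_additive]
theorem subgroup_relIndex_eq_index_of_sup_eq_top [N.Normal] (h : H ⊔ N = ⊤) :
    H.relIndex N = H.index := by
  rw [← Subgroup.relIndex_top_right]
  let f := Subgroup.quotientSubgroupOfEmbeddingOfLE H (le_top : N ≤ ⊤)
  refine Nat.card_congr (Equiv.ofBijective f ⟨f.injective, fun y => ?_⟩)
  obtain ⟨⟨x, -⟩, rfl⟩ := QuotientGroup.mk_surjective y
  obtain ⟨n, hn, c, hc, rfl⟩ : ∃ n ∈ N, ∃ c ∈ H, n * c = x :=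
    Subgroup.mem_sup_of_normal_left.mp (by rw [sup_comm, h]; trivial)
  refine ⟨QuotientGroup.mk ⟨n, hn⟩, QuotientGroup.eq.mpr ?_⟩
  simpa [Subgroup.mem_subgroupOf] using hc

@[to_additive]
theorem map_mem_of_le_of_isCyclic {f : G →* G} [IsCyclic N] (hf : ∀ x ∈ N, f x ∈ N) (hHN : H ≤ N)
    {x : G} (hx : x ∈ H) : f x ∈ H := by
  let fN : N →* N := (f.comp N.subtype).codRestrict N fun y => hf y y.2
  obtain ⟨m, hm⟩ := fN.map_cyclic
  have hfx : f x = x ^ m := congrArg Subtype.val (hm ⟨x, hHN hx⟩)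
  exact hfx ▸ H.zpow_mem hx m

end GroupTheory

namespace SkewBrace

variable {B : Type*} [SkewBrace B]

theorem mul_eq_add_lam (a b : B) : a * b = a + lam a b := by
  rw [lam_apply, add_neg_cancel_left]

section Hom

variable {B' : Type*} [SkewBrace B'] (f : B →+ B') (hf : ∀ a b, f (a * b) = f a * f b)

namespace Subbrace

/-- The image of a subbrace under a homomorphism of skew braces, that is, an additive homomorphism
`f` which also satisfies the multiplicativity condition `hf`. -/
def map (C : Subbrace B) : Subbrace B' where
  toAddSubgroup := C.toAddSubgroup.map f
  mul_mem' := (C.toSubgroup.map (MonoidHom.mk' f hf)).mul_mem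
  one_mem' := (C.toSubgroup.map (MonoidHom.mk' f hf)).one_mem
  inv_mem' := (C.toSubgroup.map (MonoidHom.mk' f hf)).inv_mem

/-- The preimage of a subbrace under a homomorphism of skew braces, encoded as for `map`. -/
def comap (D : Subbrace B') : Subbrace B where
  toAddSubgroup := D.toAddSubgroup.comap f
  mul_mem' := (D.toSubgroup.comap (MonoidHom.mk' f hf)).mul_mem
  one_mem' := (D.toSubgroup.comap (MonoidHom.mk' f hf)).one_mem
  inv_mem' := (D.toSubgroup.comap (MonoidHom.mk' f hf)).inv_mem

theorem gc_map_comap : GaloisConnection (map f hf) (comap f hf) :=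
  fun _ _ => Set.image_subset_iff

theorem toAddSubgroup_comap_map (C : Subbrace B) :
    (comap f hf (map f hf C)).toAddSubgroup = C.toAddSubgroup ⊔ f.ker :=
  C.toAddSubgroup.comap_map_eq f

theorem toSubgroup_comap_map (C : Subbrace B) :
    (comap f hf (map f hf C)).toSubgroup = C.toSubgroup ⊔ (MonoidHom.mk' f hf).ker :=
  C.toSubgroup.comap_map_eq (MonoidHom.mk' f hf)

variable {f}

theorem comap_map_eq_self {C : Subbrace B} (hker : f.ker ≤ C.toAddSubgroup) :
    comap f hf (map f hf C) = C :=
  SetLike.ext fun x => SetLike.ext_iff.mp (AddSubgroup.comap_map_eq_self hker) x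

theorem isCoatom_map (hsurj : Function.Surjective f) {C : Subbrace B} (hC : IsCoatom C)
    (hker : f.ker ≤ C.toAddSubgroup) : IsCoatom (map f hf C) := by
  have gi : GaloisInsertion (map f hf) (comap f hf) := (gc_map_comap f hf).toGaloisInsertion
    fun D => (Set.image_preimage_eq (D : Set B') hsurj).ge
  exact gi.isCoatom_of_image (by rwa [comap_map_eq_self hf hker])

theorem hasIndex_map_iff (hsurj : Function.Surjective f) {C : Subbrace B}
    (hker : f.ker ≤ C.toAddSubgroup) {n : ℕ} : (map f hf C).HasIndex n ↔ C.HasIndex n := by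
  have hadd : (map f hf C).toAddSubgroup.index = C.toAddSubgroup.index :=
    AddSubgroup.index_map_eq _ hsurj hker
  have hker' : (MonoidHom.mk' f hf).ker ≤ C.toSubgroup := fun x hx =>
    hker ((MonoidHom.mem_ker.mp hx).trans one_eq_zero)
  have hmul : (map f hf C).toSubgroup.index = C.toSubgroup.index :=
    Subgroup.index_map_eq (f := MonoidHom.mk' f hf) C.toSubgroup hsurj hker'
  simp only [HasIndex, AddSubgroup.finiteIndex_iff, Subgroup.finiteIndex_iff, hadd, hmul]

end Subbrace

variable {f} in
/-- The image of an ideal under a surjective homomorphism of skew braces. -/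
def BraceIdeal.map (hsurj : Function.Surjective f) (I : BraceIdeal B) : BraceIdeal B' where
  toSubbrace := I.toSubbrace.map f hf
  lam_mem b' x' := by
    rintro ⟨x, hx, rfl⟩
    obtain ⟨b, rfl⟩ := hsurj b'
    exact ⟨lam b x, I.lam_mem b hx, by rw [lam_apply, map_add, map_neg, hf, lam_apply]⟩
  add_normal := I.add_normal.map f hsurj
  mul_normal := I.mul_normal.map (MonoidHom.mk' f hf) hsurj

end Hom

namespace BraceIdeal

variable (I : BraceIdeal B)

/-- The projection `B → B / I` as a homomorphism of multiplicative groups. -/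
def mkMul : B →* I.Quot := MonoidHom.mk' (Quot.mkAdd I) (Quot.mkAdd_mul I)

theorem ker_mkAdd : (Quot.mkAdd I).ker = I.toAddSubgroup := QuotientAddGroup.ker_mk' _

theorem ker_mkMul : I.mkMul.ker = I.toSubgroup := Subgroup.ext fun x => by
  have h : I.mkMul x = 1 ↔ Quot.mkAdd I x = 0 := by rw [← one_eq_zero]; rfl
  rw [MonoidHom.mem_ker, h, ← AddMonoidHom.mem_ker, ker_mkAdd]
  rfl

theorem relIndex_toAddSubgroup_eq_relIndex_toSubgroup (C : Subbrace B) :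
    I.toAddSubgroup.relIndex C.toAddSubgroup = I.toSubgroup.relIndex C.toSubgroup := by
  rw [← ker_mkAdd, ← ker_mkMul, AddSubgroup.relIndex_ker, Subgroup.relIndex_ker]
  rfl

variable {I} {C : Subbrace B}

theorem comap_map_eq_top (hC : IsCoatom C) (hI : ¬ I.toSubbrace ≤ C) :
    Subbrace.comap _ (Quot.mkAdd_mul I) (Subbrace.map _ (Quot.mkAdd_mul I) C) = ⊤ := by
  refine hC.2 _ (lt_of_le_not_ge ((Subbrace.gc_map_comap _ _).le_u_l C) fun h => hI ?_)
  refine le_trans (fun x hx => ?_) h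
  change x ∈ (Subbrace.comap _ _ _).toAddSubgroup
  rw [Subbrace.toAddSubgroup_comap_map, ker_mkAdd]
  exact AddSubgroup.mem_sup_right hx

theorem toAddSubgroup_sup_eq_top (hC : IsCoatom C) (hI : ¬ I.toSubbrace ≤ C) :
    C.toAddSubgroup ⊔ I.toAddSubgroup = ⊤ := by
  rw [← ker_mkAdd, ← Subbrace.toAddSubgroup_comap_map _ (Quot.mkAdd_mul I), comap_map_eq_top hC hI]
  rfl

theorem toSubgroup_sup_eq_top (hC : IsCoatom C) (hI : ¬ I.toSubbrace ≤ C) :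
    C.toSubgroup ⊔ I.toSubgroup = ⊤ := by
  rw [← ker_mkMul, mkMul, ← Subbrace.toSubgroup_comap_map, comap_map_eq_top hC hI]
  rfl

end BraceIdeal

/-- The additive subgroup `S` underlies an ideal of `B`. This lets the order-theoretic hypothesis
"every additive subgroup of an ideal is itself an ideal" be phrased inside `AddSubgroup B`. -/
def IsIdeal (S : AddSubgroup B) : Prop := ∃ I : BraceIdeal B, I.toAddSubgroup = S

theorem isIdeal_of_subset_socle {S : AddSubgroup B} (hS : (S : Set B) ⊆ socle B)
    (hlam : ∀ b, ∀ x ∈ S, lam b x ∈ S) : IsIdeal S := by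
  have hadd : ∀ x ∈ S, ∀ y, x * y = x + y := fun x hx y => by
    rw [mul_eq_add_lam, (hS hx).1]
    rfl
  have hcenter : ∀ x ∈ S, ∀ b, b + x = x + b := fun x hx =>
    AddSubgroup.mem_center_iff.mp (hS hx).2
  have hinv : ∀ x ∈ S, x⁻¹ = -x := fun x hx =>
    inv_eq_of_mul_eq_one_right (by rw [hadd x hx, add_neg_cancel, one_eq_zero])
  have hconj : ∀ x ∈ S, ∀ b, b * x * b⁻¹ = lam b x := fun x hx b => by
    have hmem : lam b x ∈ S := hlam b x hx
    rw [mul_eq_add_lam b x, hcenter _ hmem, ← hadd _ hmem, mul_inv_cancel_right]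
  exact ⟨{
    toAddSubgroup := S
    mul_mem' {x y} hx hy := by rw [hadd x hx]; exact S.add_mem hx hy
    one_mem' := by rw [one_eq_zero]; exact S.zero_mem
    inv_mem' {x} hx := (hinv x hx).symm ▸ S.neg_mem hx
    lam_mem := hlam
    add_normal := ⟨fun x hx b => by rwa [hcenter x hx, add_neg_cancel_right]⟩
    mul_normal := ⟨fun x hx b => (hconj x hx b).symm ▸ hlam b x hx⟩ }, rfl⟩

theorem BraceIdeal.isIdeal_of_le_of_isAddCyclic {J : BraceIdeal B} [IsAddCyclic J.toAddSubgroup]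
    (hJ : (J.toAddSubgroup : Set B) ⊆ socle B) {S : AddSubgroup B} (hS : S ≤ J.toAddSubgroup) :
    IsIdeal S :=
  isIdeal_of_subset_socle (fun _ hx => hJ (hS hx)) fun b _ hx =>
    map_mem_of_le_of_isAddCyclic (f := (lam b : B →+ B)) (fun _ => J.lam_mem b) hS hx

theorem isIdeal_bot : IsIdeal (⊥ : AddSubgroup B) :=
  isIdeal_of_subset_socle (by
    rintro _ rfl
    refine ⟨AddEquiv.ext fun b => ?_, AddSubgroup.zero_mem _⟩
    rw [← one_eq_zero, lam_one, AddEquiv.refl_apply]) (by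
    rintro b _ rfl
    exact map_zero _)

theorem BraceIdeal.isIdeal_of_le_of_prime_card {J : BraceIdeal B}
    (hJ : (Nat.card J.toAddSubgroup).Prime) {S : AddSubgroup B} (hS : S ≤ J.toAddSubgroup) :
    IsIdeal S := by
  have : Fact (Nat.card J.toAddSubgroup).Prime := ⟨hJ⟩
  rcases (S.addSubgroupOf J.toAddSubgroup).eq_bot_or_eq_top_of_prime_card with h | h
  · rw [AddSubgroup.addSubgroupOf_eq_bot, disjoint_of_le_iff_left_eq_bot hS] at h
    exact h ▸ isIdeal_bot
  · exact ⟨J, (AddSubgroup.addSubgroupOf_eq_top.mp h).antisymm hS⟩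

theorem inf_covBy_of_isCoatom {J : BraceIdeal B}
    (hJ : ∀ S ≤ J.toAddSubgroup, IsIdeal S) {C : Subbrace B} (hC : IsCoatom C)
    (hJC : ¬ J.toSubbrace ≤ C) : C.toAddSubgroup ⊓ J.toAddSubgroup ⋖ J.toAddSubgroup := by
  refine ⟨lt_of_le_of_ne inf_le_right fun h => hJC (inf_eq_right.mp h), fun S hS hSJ => ?_⟩
  obtain ⟨M, rfl⟩ := hJ S hSJ.le
  have hMC : ¬ M.toSubbrace ≤ C := fun h => hS.not_ge (le_inf h hSJ.le)
  refine hSJ.not_ge fun x hx => ?_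
  have htop : x ∈ C.toAddSubgroup ⊔ M.toAddSubgroup :=
    BraceIdeal.toAddSubgroup_sup_eq_top hC hMC ▸ AddSubgroup.mem_top x
  obtain ⟨c, hc, m, hm, rfl⟩ := AddSubgroup.mem_sup_of_normal_right.mp htop
  have hcJ : c ∈ J.toAddSubgroup := (add_mem_cancel_right (hSJ.le hm)).mp hx
  exact add_mem (hS.le ⟨hc, hcJ⟩) hm

theorem exists_prime_hasIndex_of_not_le {J : BraceIdeal B}
    (hJ : ∀ S ≤ J.toAddSubgroup, IsIdeal S) {C : Subbrace B} (hC : IsCoatom C)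
    (hJC : ¬ J.toSubbrace ≤ C) : ∃ p : ℕ, p.Prime ∧ C.HasIndex p := by
  have hcov := inf_covBy_of_isCoatom hJ hC hJC
  obtain ⟨K, hK⟩ := hJ _ hcov.le
  have hKmul : K.toSubgroup = C.toSubgroup ⊓ J.toSubgroup :=
    SetLike.ext fun x => SetLike.ext_iff.mp hK x
  have hadd : C.toAddSubgroup.index = K.toAddSubgroup.relIndex J.toAddSubgroup := by
    rw [hK, AddSubgroup.inf_relIndex_right, addSubgroup_relIndex_eq_index_of_sup_eq_top
      (BraceIdeal.toAddSubgroup_sup_eq_top hC hJC)]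
  have hmul : C.toSubgroup.index = K.toAddSubgroup.relIndex J.toAddSubgroup := by
    rw [K.relIndex_toAddSubgroup_eq_relIndex_toSubgroup, hKmul, Subgroup.inf_relIndex_right,
      subgroup_relIndex_eq_index_of_sup_eq_top (BraceIdeal.toSubgroup_sup_eq_top hC hJC)]
  have hp : (K.toAddSubgroup.relIndex J.toAddSubgroup).Prime :=
    prime_relIndex_of_addSubgroup_covBy (hK ▸ hcov)
  exact ⟨_, hp, ⟨hadd ▸ hp.ne_zero⟩, ⟨hmul ▸ hp.ne_zero⟩, hadd, hmul⟩

theorem exists_prime_hasIndex_of_factor {I J : BraceIdeal B}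
    (hJ : ∀ S ≤ I.factor J, IsIdeal S) {C : Subbrace B} (hC : IsCoatom C)
    (hIC : I.toSubbrace ≤ C) (hJC : ¬ J.toSubbrace ≤ C) : ∃ p : ℕ, p.Prime ∧ C.HasIndex p := by
  have hker : (BraceIdeal.Quot.mkAdd I).ker ≤ C.toAddSubgroup := I.ker_mkAdd.trans_le hIC
  have hf := BraceIdeal.Quot.mkAdd_mul I
  have hsurj := BraceIdeal.Quot.mkAdd_surjective I
  have hJC' : ¬ (J.map hf hsurj).toSubbrace ≤ C.map _ hf := fun h => hJC <|
    (Subbrace.gc_map_comap _ hf _ _).mp h |>.trans_eq (Subbrace.comap_map_eq_self hf hker)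
  obtain ⟨p, hp, hCp⟩ :=
    exists_prime_hasIndex_of_not_le hJ (Subbrace.isCoatom_map hf hsurj hC hker) hJC'
  exact ⟨p, hp, (Subbrace.hasIndex_map_iff hf hsurj hker).mp hCp⟩

theorem isIdeal_of_le_factor {I J : BraceIdeal B}
    (h : (IsAddCyclic (I.factor J) ∧ (I.factor J : Set I.Quot) ⊆ socle I.Quot) ∨
      (Nat.card (I.factor J)).Prime) {S : AddSubgroup I.Quot} (hS : S ≤ I.factor J) :
    IsIdeal S := by
  let J' : BraceIdeal I.Quot :=
    J.map (BraceIdeal.Quot.mkAdd_mul I) (BraceIdeal.Quot.mkAdd_surjective I)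
  rcases h with ⟨hcyc, hsoc⟩ | hprime
  · have : IsAddCyclic J'.toAddSubgroup := hcyc
    exact J'.isIdeal_of_le_of_isAddCyclic hsoc hS
  · exact J'.isIdeal_of_le_of_prime_card hprime hS

theorem exists_le_and_not_succ_le {n : ℕ} {I : ℕ → BraceIdeal B} (h0 : (I 0).carrier = {0})
    (hn : (I n).carrier = Set.univ) {C : Subbrace B} (hC : C ≠ ⊤) :
    ∃ i < n, (I i).toSubbrace ≤ C ∧ ¬ (I (i + 1)).toSubbrace ≤ C := by
  by_contra! hstep
  have hle : ∀ i ≤ n, (I i).toSubbrace ≤ C := fun i => by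
    induction i with
    | zero => exact fun _ x hx => (h0.subset hx : x = 0) ▸ C.toAddSubgroup.zero_mem
    | succ i ih => exact fun hi => hstep i hi (ih (Nat.le_of_succ_le hi))
  exact hC (top_le_iff.mp fun x _ => hle n le_rfl (hn.superset (Set.mem_univ x)))

end SkewBrace

theorem theorem3p14_general {B : Type*} [SkewBrace B] {n : ℕ} {I : ℕ → SkewBrace.BraceIdeal B}
    (h0 : (I 0).carrier = {0}) (hn : (I n).carrier = Set.univ)
    (hI : ∀ i < n, ∀ S ≤ (I i).factor (I (i + 1)), SkewBrace.IsIdeal S)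
    (C : SkewBrace.Subbrace B) (hC : IsCoatom C) :
    (∃ p : ℕ, p.Prime ∧ C.HasIndex p) ∧
      (IsCoatom C.toAddSubgroup ∧ C.toAddSubgroup.index.Prime) ∧
      (IsCoatom C.toSubgroup ∧ C.toSubgroup.index.Prime) := by
  obtain ⟨i, hi, hIC, hJC⟩ := SkewBrace.exists_le_and_not_succ_le h0 hn hC.1
  obtain ⟨p, hp, hindex⟩ := SkewBrace.exists_prime_hasIndex_of_factor (hI i hi) hC hIC hJC
  obtain ⟨-, -, hadd, hmul⟩ := id hindex
  have hadd : C.toAddSubgroup.index.Prime := hadd ▸ hp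
  have hmul : C.toSubgroup.index.Prime := hmul ▸ hp
  exact ⟨⟨p, hp, hindex⟩, ⟨isCoatom_addSubgroup_of_prime_index hadd, hadd⟩,
    ⟨isCoatom_subgroup_of_prime_index hmul, hmul⟩⟩

/-- `IsCoatom` says "maximal": for `C` among all subbraces, and for `(C, +)`, `(C, *)` among all
subgroups of `(B, +)`, `(B, *)`. -/
theorem theorem3p14 {B : Type*} [SkewBrace B] (hB : SkewBrace.IsSupersoluble B)
    (C : SkewBrace.Subbrace B) (hC : IsCoatom C) :
    (∃ p : ℕ, p.Prime ∧ C.HasIndex p) ∧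
      (IsCoatom C.toAddSubgroup ∧ C.toAddSubgroup.index.Prime) ∧
      (IsCoatom C.toSubgroup ∧ C.toSubgroup.index.Prime) := by
  obtain ⟨n, I, h0, hn, hI⟩ := hB
  exact theorem3p14_general h0 hn (fun i hi _ => SkewBrace.isIdeal_of_le_factor
    ((hI i hi).2.imp_left fun ⟨hcyc, _, hsoc⟩ => ⟨hcyc, hsoc⟩)) C hC
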